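/- Consider words over the alphabet $\{a,b\}$. Two words are abelian equivalent if each letter occurs equally often in both. An internal abelian-border of a pair $(u,v)$ is a pair $(x,y)$ of abelian equivalent words where $x$ is a nonempty proper suffix of $u$ and $y$ is a proper prefix of $v$; an external abelian-border of $(u,v)$ is a pair $(x,y)$ of abelian equivalent words where $x$ is a nonempty proper prefix of $u$ and $y$ is a proper suffix of $v$. A pair $(u,v)$ of words of equal length is an MAB pair if it has both an internal and an external abelian-border. Let $\mathrm{lsb}(u,v)$ be the length of $x$ in the shortest internal abelian-border $(x,y)$ of $(u,v)$. For $n\ge 0$ and $g\ge 1$ let $\mathcal M^{\mathrm o}_g(n)$ be the number of MAB pairs $(u,v)$ with $|u|=|v|=n$ for which $i=\mathrm{lsb}(u,v)$ and $j=\mathrm{lsb}(v,u)$ satisfy $i+j-n=g$, i.e. the two shortest borders overlap in exactly $g$ letters. Then, with empty sums equal to $0$, $$\mathcal M^{\mathrm o}_1(n)=2\sum_{i=2}^{n-1}\sum_{l_1=1}^{n-i}\sum_{m=l_1+1}^{i+l_1-1}\frac{1}{(i-1)(n-i)}\binom{n-i}{l_1}\binom{n-i}{l_1-1}\binom{i-1}{m-l_1}\binom{i-1}{m-l_1-1},$$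 $$\mathcal M^{\mathrm o}_2(n)=2\sum_{i=3}^{n-2}\sum_{l_1=2}^{n-i}\sum_{m=l_1+2}^{i+l_1-2}\frac{4}{(i-2)(n-i)}\binom{n-i}{l_1}\binom{n-i}{l_1-2}\binom{i-2}{m-l_1}\binom{i-2}{m-l_1-2}.$$ Moreover, for lattice points $A,B,C\in\mathbb Z^2$ let ${}_A N_B^C$ be the number of triples $(p,q,p')$ of lattice paths with unit steps to the right or up such that $p$ goes from $A$ to $C$, $q$ goes from $B$ to $C$, $p'$ is the translate of $p$ starting at $B$, the only lattice point common to $p$ and $q$ is $C$, and the only lattice point common to $q$ and $p'$ is $B$. Then for all integers $x,y$ and each $g\in\{1,2\}$, ${}_A N_B^C=1$ for $A=(x-g,y+g)$, $B=(x,y)$, $C=(x,y+g)$. -/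

import Mathlib

namespace MAB

/-- The letter `a` of the binary alphabet `{a, b}`, modelled by `Bool`. -/
abbrev a : Bool := true

/-- The letter `b` of the binary alphabet `{a, b}`, modelled by `Bool`. -/
abbrev b : Bool := false

/-- Binary words. -/
abbrev Word : Type := List Bool

/-- Abelian equivalence: every letter occurs equally often in both words. -/
def AbelianEquiv (x y : Word) : Prop :=
  ∀ c : Bool, x.count c = y.count c

/-- `(x, y)` is an internal abelian-border of `(u, v)`: `x` is a nonempty proper suffix of `u`
and `y` is a proper prefix of `v` with `x` and `y` abelian equivalent. -/
def IsInternalBorder (u v x y : Word) : Prop :=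
  x ≠ [] ∧ x <:+ u ∧ x ≠ u ∧ y <+: v ∧ y ≠ v ∧ AbelianEquiv x y

/-- `(x, y)` is an external abelian-border of `(u, v)`: `x` is a nonempty proper prefix of `u`
and `y` is a proper suffix of `v` with `x` and `y` abelian equivalent. -/
def IsExternalBorder (u v x y : Word) : Prop :=
  x ≠ [] ∧ x <+: u ∧ x ≠ u ∧ y <:+ v ∧ y ≠ v ∧ AbelianEquiv x y

/-- `(u, v)` is mutually abelian-bordered: it has an internal and an external abelian-border. -/
def IsMutuallyBordered (u v : Word) : Prop :=
  (∃ x y, IsInternalBorder u v x y) ∧ (∃ x y, IsExternalBorder u v x y)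

/-- The length of the shortest internal abelian-border of `(u, v)`; it is `0` if `(u, v)` has no
internal abelian-border, since the infimum of the empty set of natural numbers is `0`. -/
noncomputable def lsb (u v : Word) : ℕ :=
  sInf {k | ∃ x y, IsInternalBorder u v x y ∧ x.length = k}

/-- The MAB pairs `(u, v)` of words of length `n` whose shortest borders, of lengths
`i = lsb u v` and `j = lsb v u`, overlap in exactly `g` letters: `i + j - n = g`. -/
def overlapPairs (n g : ℕ) : Set (Word × Word) :=
  {w | w.1.length = n ∧ w.2.length = n ∧ IsMutuallyBordered w.1 w.2 ∧
    lsb w.1 w.2 + lsb w.2 w.1 = n + g}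

/-- The number of MAB pairs of words of length `n` whose shortest borders overlap in exactly
`g` letters. -/
noncomputable def numOverlapPairs (n g : ℕ) : ℕ :=
  (overlapPairs n g).ncard

/-- The end point of the lattice path that starts at `A` and is coded by the word `w`
(`a` is a unit step to the right, `b` a unit step up). -/
def endPoint (A : ℤ × ℤ) (w : Word) : ℤ × ℤ :=
  (A.1 + (w.count a : ℤ), A.2 + (w.count b : ℤ))

/-- The set of lattice points on the lattice path that starts at `A` and is coded by `w`. -/
def pathPoints (A : ℤ × ℤ) (w : Word) : Set (ℤ × ℤ) :=
  {P | ∃ t : Word, t <+: w ∧ P = endPoint A t}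

/-- The triples of lattice paths `(p, q, p')`, each path given by its word, such that `p` goes
from `A` to `C`, `q` goes from `B` to `C`, `p'` starts at `B` and has the same word as `p`,
`p` and `q` meet only in `C`, and `q` and `p'` meet only in `B`. -/
def middleTriples (A B C : ℤ × ℤ) : Set (Word × Word × Word) :=
  {t | endPoint A t.1 = C ∧ endPoint B t.2.1 = C ∧ t.2.2 = t.1 ∧
    pathPoints A t.1 ∩ pathPoints B t.2.1 = {C} ∧
    pathPoints B t.2.1 ∩ pathPoints B t.2.2 = {B}}

/-- The number of triples of lattice paths in `middleTriples A B C`. -/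
noncomputable def numMiddleTriples (A B C : ℤ × ℤ) : ℕ :=
  (middleTriples A B C).ncard

end MAB

namespace MAB

/-! Read `u` backwards and `v` forwards in parallel, and let h(k) be the number of `a`s in the last
k letters of `u` minus that in the first k letters of `v`. Then h has steps in {-1, 0, 1}. Internal
borders of length k are its zeros with 0 < k < n, and external ones are the points n - k at which h
takes its final value h(n) (`exists_internalBorder_iff`, `zeroAt_dual_iff`). An overlap of g thus
says that the first interior zero i lies g places after the last interior point p with h(p) = h(n).

Exchanging `u` and `v` letterwise negates h, so assume h(n) > 0; this costs the factor 2. By a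
discrete intermediate value argument h > 0 on (0, i) and h < h(n) on (p, n). For g = 1, 2 the
stretch from p to i then has to be g consecutive descents, and h(n) = g (`exists_glue_of_overlap`).
What remains is a list of length i - g before it and one of length n - i after it, both of height g,
and both with positive suffixes once the former is reversed. They can be chosen independently
(`overlap_glue`, `injOn_compose`).

The lists of length N with positive suffixes, height g and l letters `a` in the first components
number (g/N) C(N, l) C(N, l - g), a ballot count (`card_posLists`, `mul_card_posLists`). Multiplying
the two counts and summing over i gives both formulas. The statement on path triples is separate:
the end points force p and q to be straight. -/

/-- The contribution of a pair of letters to the difference of the numbers of `a`s. -/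
def step (c : Bool × Bool) : ℤ := (if c.1 then 1 else 0) - (if c.2 then 1 else 0)

/-- The number of `a`s among the first components minus that among the second components. -/
def height (w : List (Bool × Bool)) : ℤ := (w.map step).sum

@[simp] lemma height_nil : height [] = 0 := rfl

@[simp] lemma height_cons (c : Bool × Bool) (w) : height (c :: w) = step c + height w := by
  simp [height]

@[simp] lemma height_append (w z) : height (w ++ z) = height w + height z := by
  simp [height]

@[simp] lemma height_reverse (w) : height w.reverse = height w := by
  simp [height, List.sum_reverse]

lemma step_swap (c : Bool × Bool) : step c.swap = -step c := by simp [step]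

@[simp] lemma height_map_swap (w) : height (w.map Prod.swap) = -height w := by
  induction w with
  | nil => simp
  | cons c w ih => simp only [List.map_cons, height_cons, ih, step_swap]; ring

lemma step_le (c : Bool × Bool) : step c ≤ 1 := by
  rcases c with ⟨_ | _, _ | _⟩ <;> simp [step]

lemma le_step (c : Bool × Bool) : -1 ≤ step c := by
  rcases c with ⟨_ | _, _ | _⟩ <;> simp [step]

lemma eq_of_step_eq_neg_one {c : Bool × Bool} (h : step c = -1) : c = (false, true) := by
  rcases c with ⟨_ | _, _ | _⟩ <;> simp_all [step]

lemma height_eq_count (w : List (Bool × Bool)) :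
    height w = ((w.map Prod.fst).count true : ℤ) - (w.map Prod.snd).count true := by
  induction w with
  | nil => simp
  | cons c w ih =>
    rcases c with ⟨_ | _, _ | _⟩ <;> simp [ih, step] <;> ring

lemma height_take_add_drop (w : List (Bool × Bool)) (k : ℕ) :
    height (w.take k) + height (w.drop k) = height w := by
  rw [← height_append, List.take_append_drop]

/-- The pair of words `(u, v)` coded by the list of the pairs `(u_{n+1-k}, v_k)`. -/
def decode (w : List (Bool × Bool)) : Word × Word := ((w.map Prod.fst).reverse, w.map Prod.snd)

/-- The code of `(v, u)` in terms of that of `(u, v)`. -/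
def dual (w : List (Bool × Bool)) : List (Bool × Bool) := (w.map Prod.swap).reverse

lemma decode_dual (w) : decode (dual w) = (decode w).swap := by
  simp [decode, dual, Function.comp_def]

@[simp] lemma length_dual (w) : (dual w).length = w.length := by simp [dual]

lemma decode_injective : Function.Injective decode := by
  intro w z h
  simp only [decode, Prod.mk.injEq, List.reverse_inj] at h
  rw [← List.zip_unzip w, ← List.zip_unzip z]
  simp [List.unzip_eq_map, h.1, h.2]

lemma exists_decode {u v : Word} (h : u.length = v.length) : ∃ w, decode w = (u, v) := by
  refine ⟨u.reverse.zip v, ?_⟩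
  simp [decode, List.map_fst_zip, List.map_snd_zip, h]

/-- The height function of `w` vanishes at the interior point `k`. -/
def ZeroAt (w : List (Bool × Bool)) (k : ℕ) : Prop :=
  0 < k ∧ k < w.length ∧ height (w.take k) = 0

lemma AbelianEquiv.length_eq {x y : Word} (h : AbelianEquiv x y) : x.length = y.length := by
  rw [← List.count_true_add_count_false x, ← List.count_true_add_count_false y, h, h]

/-- Reversing `u` turns its suffixes into prefixes, so both words of a border are read off `w.take
k`. In a binary alphabet, equal lengths and equally many `a`s suffice for abelian equivalence. -/
lemma exists_internalBorder_iff (w : List (Bool × Bool)) (k : ℕ) :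
    (∃ x y, IsInternalBorder (decode w).1 (decode w).2 x y ∧ x.length = k) ↔ ZeroAt w k := by
  constructor
  · rintro ⟨x, y, ⟨hx, hxu, hne, hyv, -, hab⟩, rfl⟩
    have hlen := hab.length_eq
    have hlt : x.length < w.length := by
      have h1 : x.length ≤ w.length := by simpa [decode] using hxu.length_le
      refine lt_of_le_of_ne h1 fun h => hne (hxu.eq_of_length (by simpa [decode] using h))
    refine ⟨List.length_pos_iff.2 hx, hlt, ?_⟩
    have e1 : x.reverse = (w.take x.length).map Prod.fst := by
      have := List.reverse_prefix.2 hxu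
      rw [List.prefix_iff_eq_take] at this
      simpa [decode, List.map_take] using this
    have e2 : y = (w.take x.length).map Prod.snd := by
      rw [List.prefix_iff_eq_take] at hyv
      rw [hlen]
      simpa [decode, List.map_take] using hyv
    rw [height_eq_count, ← e1, ← e2, List.count_reverse, hab true, sub_self]
  · rintro ⟨h0, hk, hz⟩
    have hl : (w.take k).length = k := by simp; omega
    have hc : ((w.take k).map Prod.fst).count true = ((w.take k).map Prod.snd).count true := by
      rw [height_eq_count] at hz; omega
    refine ⟨((w.take k).map Prod.fst).reverse, (w.take k).map Prod.snd,
      ⟨?_, ?_, ?_, ?_, ?_, ?_⟩, by simpa using hk.le⟩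
    · intro h
      have := congrArg List.length h
      simp only [List.length_reverse, List.length_map, hl, List.length_nil] at this
      omega
    · rw [decode, ← List.reverse_prefix, List.reverse_reverse, List.reverse_reverse, List.map_take]
      exact List.take_prefix _ _
    · intro h
      have := congrArg List.length h
      simp only [decode, List.length_reverse, List.length_map, hl] at this
      omega
    · rw [decode, List.map_take]
      exact List.take_prefix _ _
    · intro h
      have := congrArg List.length h
      simp only [decode, List.length_map, hl] at this
      omega
    · have h1 := List.count_true_add_count_false ((w.take k).map Prod.fst)
      have h2 := List.count_true_add_count_false ((w.take k).map Prod.snd)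
      rw [List.length_map] at h1 h2
      rintro (_ | _) <;> rw [List.count_reverse] <;> omega

lemma isExternalBorder_iff {u v x y : Word} :
    IsExternalBorder u v x y ↔ IsInternalBorder v u y x := by
  have key : AbelianEquiv x y → (x ≠ [] ↔ y ≠ []) := fun h => by
    rw [← List.length_pos_iff, ← List.length_pos_iff, h.length_eq]
  have symm : AbelianEquiv x y ↔ AbelianEquiv y x :=
    ⟨fun h c => (h c).symm, fun h c => (h c).symm⟩
  unfold IsExternalBorder IsInternalBorder
  rw [← symm]
  tauto

/-- The first interior zero of the height function is `k`. -/
def FirstZero (w : List (Bool × Bool)) (k : ℕ) : Prop :=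
  ZeroAt w k ∧ ∀ m, ZeroAt w m → k ≤ m

lemma FirstZero.unique {w : List (Bool × Bool)} {k m : ℕ} (hk : FirstZero w k)
    (hm : FirstZero w m) : k = m :=
  le_antisymm (hk.2 _ hm.1) (hm.2 _ hk.1)

lemma exists_internal_and_lsb_eq_iff (w : List (Bool × Bool)) (k : ℕ) :
    ((∃ x y, IsInternalBorder (decode w).1 (decode w).2 x y) ∧
      lsb (decode w).1 (decode w).2 = k) ↔ FirstZero w k := by
  have hs : {k | ∃ x y, IsInternalBorder (decode w).1 (decode w).2 x y ∧ x.length = k} =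
      {k | ZeroAt w k} := Set.ext fun k => exists_internalBorder_iff w k
  rw [lsb, hs]
  constructor
  · rintro ⟨⟨x, y, h⟩, rfl⟩
    have hne : {k | ZeroAt w k}.Nonempty :=
      ⟨x.length, (exists_internalBorder_iff w _).1 ⟨x, y, h, rfl⟩⟩
    exact ⟨Nat.sInf_mem hne, fun m hm => Nat.sInf_le hm⟩
  · intro h
    obtain ⟨x, y, hxy, -⟩ := (exists_internalBorder_iff w k).2 h.1
    exact ⟨⟨x, y, hxy⟩, IsLeast.csInf_eq ⟨h.1, fun m hm => h.2 m hm⟩⟩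

/-- The first interior zeros of `w` and of its dual overlap by `g`, the former being `i`. -/
def Overlap (g i : ℕ) (w : List (Bool × Bool)) : Prop :=
  ∃ j, FirstZero w i ∧ FirstZero (dual w) j ∧ i + j = w.length + g

lemma decode_mem_overlapPairs_iff (w : List (Bool × Bool)) (n g : ℕ) :
    decode w ∈ overlapPairs n g ↔ w.length = n ∧ ∃ i, Overlap g i w := by
  have hd1 : (decode (dual w)).1 = (decode w).2 := by rw [decode_dual]; rfl
  have hd2 : (decode (dual w)).2 = (decode w).1 := by rw [decode_dual]; rfl
  have h2 := exists_internal_and_lsb_eq_iff (dual w)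
  rw [hd1, hd2] at h2
  have l1 : (decode w).1.length = w.length := by simp [decode]
  have l2 : (decode w).2.length = w.length := by simp [decode]
  simp only [overlapPairs, Set.mem_ofPred_eq, l1, l2, IsMutuallyBordered, Overlap,
    ← exists_internal_and_lsb_eq_iff w, ← h2, isExternalBorder_iff]
  constructor
  · rintro ⟨rfl, -, ⟨hi, x, y, he⟩, h⟩
    exact ⟨rfl, _, _, ⟨hi, rfl⟩, ⟨⟨y, x, he⟩, rfl⟩, h⟩
  · rintro ⟨rfl, _, _, ⟨hi, rfl⟩, ⟨⟨y, x, he⟩, rfl⟩, h⟩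
    exact ⟨rfl, rfl, ⟨hi, x, y, he⟩, h⟩

/-! ### Ballot count of lists with positive suffixes -/

/-- The lists of `N` pairs of letters. -/
def pairLists : ℕ → Finset (List (Bool × Bool))
  | 0 => {[]}
  | N + 1 => ((Finset.univ ×ˢ pairLists N).image fun t => t.1 :: t.2)

@[simp] lemma mem_pairLists {N : ℕ} {w : List (Bool × Bool)} :
    w ∈ pairLists N ↔ w.length = N := by
  induction N generalizing w with
  | zero => simp [pairLists]
  | succ N ih =>
    cases w with
    | nil => simp [pairLists]
    | cons c w => simp [pairLists, ih]

lemma card_filter_pairLists_succ (N : ℕ) (p : List (Bool × Bool) → Prop) [DecidablePred p] :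
    ((pairLists (N + 1)).filter p).card =
      ∑ c : Bool × Bool, ((pairLists N).filter fun w => p (c :: w)).card := by
  have h : (pairLists (N + 1)).filter p = Finset.univ.biUnion fun c : Bool × Bool =>
      ((pairLists N).filter fun w => p (c :: w)).image (List.cons c) := by
    ext w
    cases w <;> simp
  rw [h, Finset.card_biUnion]
  · refine Finset.sum_congr rfl fun c _ => ?_
    exact Finset.card_image_of_injective _ List.cons_injective
  · intro c _ d _ hcd
    rw [Function.onFun, Finset.disjoint_left]
    intro w h1 h2
    simp only [Finset.mem_image, Finset.mem_filter] at h1 h2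
    obtain ⟨w1, -, rfl⟩ := h1
    obtain ⟨w2, -, h⟩ := h2
    exact hcd (List.cons.inj h).1.symm

/-- All nonempty suffixes have positive height. -/
def SuffixPos (w : List (Bool × Bool)) : Prop :=
  ∀ k < w.length, 0 < height (w.drop k)

lemma suffixPos_nil : SuffixPos [] := fun k hk => absurd hk (by simp)

lemma suffixPos_cons {c : Bool × Bool} {w : List (Bool × Bool)} :
    SuffixPos (c :: w) ↔ 0 < height (c :: w) ∧ SuffixPos w := by
  constructor
  · intro h
    exact ⟨h 0 (by simp), fun k hk => h (k + 1) (by simpa using hk)⟩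
  · rintro ⟨h0, h⟩ (_ | k) hk
    · exact h0
    · exact h k (by simpa using hk)

open Classical in
/-- The lists of `N` pairs with positive heights of suffixes and given numbers of `a`s. -/
noncomputable def posLists (N x y : ℕ) : Finset (List (Bool × Bool)) :=
  (pairLists N).filter fun w =>
    SuffixPos w ∧ (w.map Prod.fst).count true = x ∧ (w.map Prod.snd).count true = y

lemma mem_posLists {N x y : ℕ} {w : List (Bool × Bool)} :
    w ∈ posLists N x y ↔ w.length = N ∧ SuffixPos w ∧
      (w.map Prod.fst).count true = x ∧ (w.map Prod.snd).count true = y := by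
  simp [posLists]

lemma posLists_succ_eq_empty {N x y : ℕ} (h : x ≤ y) : posLists (N + 1) x y = ∅ := by
  refine Finset.eq_empty_of_forall_notMem fun w hw => ?_
  obtain ⟨hl, hp, hx, hy⟩ := mem_posLists.1 hw
  have := hp 0 (by omega)
  rw [List.drop_zero, height_eq_count] at this
  omega

lemma count_true_cons (c : Bool) (w : List Bool) :
    (c :: w).count true = w.count true + c.toNat := by
  cases c <;> simp

open Classical in
-- Removing the first pair loses only the condition that the whole list has positive height, which
-- `y < x` already guarantees. The guard keeps the natural subtractions from truncating.
lemma card_posLists_succ {N x y : ℕ} (h : y < x) :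
    (posLists (N + 1) x y).card = ∑ c : Bool × Bool,
      if (c.1 → 0 < x) ∧ (c.2 → 0 < y) then
        (posLists N (x - c.1.toNat) (y - c.2.toNat)).card else 0 := by
  rw [posLists, card_filter_pairLists_succ]
  refine Finset.sum_congr rfl fun c _ => ?_
  split_ifs with hc
  · rw [posLists]
    congr 1
    refine Finset.filter_congr fun w _ => ?_
    rw [suffixPos_cons, height_eq_count, List.map_cons, List.map_cons, count_true_cons,
      count_true_cons]
    have h1 : c.1.toNat ≤ x := by
      cases hb : c.1
      · simp
      · exact hc.1 hb
    have h2 : c.2.toNat ≤ y := by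
      cases hb : c.2
      · simp
      · exact hc.2 hb
    constructor
    · rintro ⟨⟨-, hp⟩, hx, hy⟩
      exact ⟨hp, by omega, by omega⟩
    · rintro ⟨hp, hx, hy⟩
      exact ⟨⟨by omega, hp⟩, by omega, by omega⟩
  · rw [Finset.card_eq_zero, Finset.filter_eq_empty_iff]
    rintro w - ⟨-, h2, h3⟩
    apply hc
    rcases c with ⟨_ | _, _ | _⟩ <;> simp at h2 h3 ⊢ <;> omega

/-- The binomial coefficient `N.choose (k - 1)`, read as `0` for `k = 0`. -/
def chooseShift (N : ℕ) : ℕ → ℤ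
  | 0 => 0
  | k + 1 => N.choose k

lemma choose_succ_eq (N k : ℕ) : ((N + 1).choose k : ℤ) = N.choose k + chooseShift N k := by
  cases k with
  | zero => simp [chooseShift]
  | succ k => rw [Nat.choose_succ_succ, chooseShift]; push_cast; ring

lemma mul_choose_succ (N k : ℕ) :
    (k : ℤ) * (N + 1).choose k = (N + 1) * chooseShift N k := by
  cases k with
  | zero => simp [chooseShift]
  | succ k =>
    rw [chooseShift]
    have := Nat.add_one_mul_choose_eq N k
    have h : ((N : ℤ) + 1) * N.choose k = (N + 1).choose (k + 1) * (k + 1) := by exact_mod_cast this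
    rw [h]; push_cast; ring

lemma posLists_zero (x y : ℕ) : (posLists 0 x y).card = if x = 0 ∧ y = 0 then 1 else 0 := by
  split_ifs with h
  · rw [Finset.card_eq_one]
    refine ⟨[], ?_⟩
    ext w
    obtain ⟨rfl, rfl⟩ := h
    rw [mem_posLists, Finset.mem_singleton, List.length_eq_zero_iff]
    constructor
    · exact fun h => h.1
    · rintro rfl
      exact ⟨rfl, suffixPos_nil, by simp, by simp⟩
  · rw [Finset.card_eq_zero]
    refine Finset.eq_empty_of_forall_notMem fun w hw => h ?_
    obtain ⟨hl, -, rfl, rfl⟩ := mem_posLists.1 hw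
    rw [List.length_eq_zero_iff] at hl
    simp [hl]

/-- The determinant obeys the same recursion as the count, by Pascal's rule in both factors. Being
antisymmetric in `x` and `y`, it vanishes on the diagonal, where there are no lists. -/
lemma card_posLists (N : ℕ) {x y : ℕ} (h : y ≤ x) : ((posLists (N + 1) x y).card : ℤ) =
    chooseShift N x * N.choose y - N.choose x * chooseShift N y := by
  induction N generalizing x y with
  | zero =>
    rcases h.eq_or_lt with rfl | h
    · rw [posLists_succ_eq_empty le_rfl]; simp; ring
    · rw [card_posLists_succ h]
      simp only [posLists_zero, Fintype.sum_prod_type, Fintype.sum_bool]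
      obtain ⟨x, rfl⟩ := Nat.exists_eq_succ_of_ne_zero (by omega : x ≠ 0)
      rcases y with _ | y <;> rcases x with _ | x <;>
        simp [chooseShift] at h ⊢
  | succ N ih =>
    rcases h.eq_or_lt with rfl | h
    · rw [posLists_succ_eq_empty le_rfl]; simp; ring
    · rw [card_posLists_succ h]
      simp only [Fintype.sum_prod_type, Fintype.sum_bool]
      obtain ⟨x, rfl⟩ := Nat.exists_eq_succ_of_ne_zero (by omega : x ≠ 0)
      rcases y with _ | y
      · simp [ih, chooseShift, Nat.choose_succ_succ, choose_succ_eq]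
        try ring
      · have e1 := ih (x := x + 1) (y := y + 1) (by omega)
        have e2 := ih (x := x) (y := y + 1) (by omega)
        have e3 := ih (x := x + 1) (y := y) (by omega)
        have e4 := ih (x := x) (y := y) (by omega)
        simp [e1, e2, e3, e4, chooseShift, Nat.choose_succ_succ, choose_succ_eq]
        ring

/-- The absorption identity `mul_choose_succ` turns the determinant into a product. -/
lemma mul_card_posLists {N : ℕ} (hN : N ≠ 0) {x y : ℕ} (h : y ≤ x) :
    (N : ℤ) * (posLists N x y).card = (x - y) * N.choose x * N.choose y := by
  obtain ⟨N, rfl⟩ := Nat.exists_eq_succ_of_ne_zero hN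
  rw [card_posLists N h]
  have hx := mul_choose_succ N x
  have hy := mul_choose_succ N y
  have hx' := choose_succ_eq N x
  have hy' := choose_succ_eq N y
  push_cast
  linear_combination (-((N + 1).choose y : ℤ)) * hx + ((N + 1).choose x : ℤ) * hy +
    (-(N + 1 : ℤ) * chooseShift N x) * hy' + ((N + 1 : ℤ) * chooseShift N y) * hx'

open Classical in
/-- The lists of `N` pairs of total height `g` with positive heights of suffixes. -/
noncomputable def posListsOfHeight (N g : ℕ) : Finset (List (Bool × Bool)) :=
  (pairLists N).filter fun w => SuffixPos w ∧ height w = g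

lemma mem_posListsOfHeight {N g : ℕ} {w : List (Bool × Bool)} :
    w ∈ posListsOfHeight N g ↔ w.length = N ∧ SuffixPos w ∧ height w = g := by
  simp [posListsOfHeight]

lemma card_posListsOfHeight (N g : ℕ) :
    (posListsOfHeight N g).card = ∑ l ∈ Finset.Icc g N, (posLists N l (l - g)).card := by
  rw [Finset.card_eq_sum_card_fiberwise (f := fun w => (w.map Prod.fst).count true)
    (t := Finset.Icc g N)]
  · refine Finset.sum_congr rfl fun l hl => ?_
    congr 1
    ext w
    rw [Finset.mem_filter, mem_posListsOfHeight, mem_posLists, height_eq_count]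
    rw [Finset.mem_Icc] at hl
    constructor
    · rintro ⟨⟨h1, h2, h3⟩, h4⟩
      exact ⟨h1, h2, h4, by omega⟩
    · rintro ⟨h1, h2, h3, h4⟩
      exact ⟨⟨h1, h2, by omega⟩, h3⟩
  · intro w hw
    obtain ⟨h1, -, h3⟩ := mem_posListsOfHeight.1 hw
    rw [height_eq_count] at h3
    have := List.count_le_length (a := true) (l := w.map Prod.fst)
    rw [List.length_map] at this
    simp only [Finset.coe_Icc, Set.mem_Icc]
    omega

lemma card_posListsOfHeight_rat {N : ℕ} (hN : N ≠ 0) (g : ℕ) :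
    ((posListsOfHeight N g).card : ℚ) =
      ∑ l ∈ Finset.Icc g N, (g : ℚ) / N * N.choose l * N.choose (l - g) := by
  rw [card_posListsOfHeight, Nat.cast_sum]
  refine Finset.sum_congr rfl fun l hl => ?_
  rw [Finset.mem_Icc] at hl
  have h : (N : ℚ) * (posLists N l (l - g)).card =
      ((l : ℚ) - (l - g : ℕ)) * N.choose l * N.choose (l - g) := by
    exact_mod_cast mul_card_posLists hN (Nat.sub_le l g)
  rw [Nat.cast_sub hl.1, sub_sub_cancel] at h
  have hN' : (N : ℚ) ≠ 0 := Nat.cast_ne_zero.2 hN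
  field_simp
  linarith

/-! ### Triples of lattice paths -/

lemma eq_replicate_of_count {w : Word} {c : Bool} {g : ℕ} (h : w.count c = g)
    (h' : w.count (!c) = 0) : w = List.replicate g c := by
  rw [List.eq_replicate_iff]
  have hmem : ∀ d ∈ w, d = c := by
    intro d hd
    by_contra hne
    rw [List.count_eq_zero] at h'
    exact h' (by rwa [← Bool.eq_not.2 hne])
  refine ⟨?_, hmem⟩
  rw [← h, List.count_eq_length.2 fun d hd => (hmem d hd).symm]

lemma pathPoints_replicate_a (A : ℤ × ℤ) (g : ℕ) :
    pathPoints A (List.replicate g a) = {P | ∃ k : ℕ, k ≤ g ∧ P = (A.1 + k, A.2)} := by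
  ext P
  constructor
  · rintro ⟨t, ht, rfl⟩
    obtain ⟨hk, ht⟩ := List.prefix_replicate_iff.1 ht
    refine ⟨t.length, hk, ?_⟩
    rw [ht]
    simp [endPoint, List.count_replicate]
  · rintro ⟨k, hk, rfl⟩
    refine ⟨List.replicate k a, List.prefix_replicate_iff.2 ⟨by simpa using hk, by simp⟩, ?_⟩
    simp [endPoint, List.count_replicate]

lemma pathPoints_replicate_b (A : ℤ × ℤ) (g : ℕ) :
    pathPoints A (List.replicate g b) = {P | ∃ k : ℕ, k ≤ g ∧ P = (A.1, A.2 + k)} := by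
  ext P
  constructor
  · rintro ⟨t, ht, rfl⟩
    obtain ⟨hk, ht⟩ := List.prefix_replicate_iff.1 ht
    refine ⟨t.length, hk, ?_⟩
    rw [ht]
    simp [endPoint, List.count_replicate]
  · rintro ⟨k, hk, rfl⟩
    refine ⟨List.replicate k b, List.prefix_replicate_iff.2 ⟨by simpa using hk, by simp⟩, ?_⟩
    simp [endPoint, List.count_replicate]

/-- The displacements (g, 0) and (0, g) already force both words; the intersection conditions only
have to be verified. -/
lemma numMiddleTriples_eq_one (g : ℕ) (x y : ℤ) :
    numMiddleTriples (x - g, y + g) (x, y) (x, y + g) = 1 := by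
  rw [numMiddleTriples, Set.ncard_eq_one]
  refine ⟨(List.replicate g a, List.replicate g b, List.replicate g a), ?_⟩
  ext ⟨p, q, p'⟩
  simp only [middleTriples, Set.mem_ofPred_eq, Set.mem_singleton_iff, Prod.mk.injEq]
  constructor
  · rintro ⟨hp, hq, hpp, -, -⟩
    simp only [endPoint, Prod.mk.injEq] at hp hq
    have h1 : p = List.replicate g a :=
      eq_replicate_of_count (by omega) (by simpa using hp.2)
    exact ⟨h1, eq_replicate_of_count (by omega) (by simpa using hq.1), hpp.trans h1⟩
  · rintro ⟨rfl, rfl, rfl⟩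
    refine ⟨by simp [endPoint, List.count_replicate], by simp [endPoint, List.count_replicate],
      rfl, ?_, ?_⟩
    · rw [pathPoints_replicate_a, pathPoints_replicate_b]
      ext ⟨r, s⟩
      simp only [Set.mem_inter_iff, Set.mem_ofPred_eq, Set.mem_singleton_iff, Prod.mk.injEq]
      constructor
      · rintro ⟨⟨k, -, h⟩, ⟨l, -, h'⟩⟩
        omega
      · rintro ⟨rfl, rfl⟩
        exact ⟨⟨g, le_rfl, by omega⟩, g, le_rfl, by omega⟩
    · rw [pathPoints_replicate_a, pathPoints_replicate_b]
      ext ⟨r, s⟩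
      simp only [Set.mem_inter_iff, Set.mem_ofPred_eq, Set.mem_singleton_iff, Prod.mk.injEq]
      constructor
      · rintro ⟨⟨k, -, h⟩, ⟨l, -, h'⟩⟩
        omega
      · rintro ⟨rfl, rfl⟩
        exact ⟨⟨0, Nat.zero_le _, by simp⟩, 0, Nat.zero_le _, by simp⟩

/-! ### Overlaps in terms of the height function -/

/-- An integer sequence that falls by at most 1 at a time cannot become negative without hitting 0.
-/
lemma pos_of_ne_zero_of_step {f : ℕ → ℤ} (hf : ∀ k, f k - 1 ≤ f (k + 1)) {p m : ℕ} (hpm : p ≤ m)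
    (h0 : ∀ k, p ≤ k → k ≤ m → f k ≠ 0) (hp : 0 < f p) : 0 < f m := by
  induction m, hpm using Nat.le_induction with
  | base => exact hp
  | succ m hm ih =>
    have h1 := ih fun k hk hk' => h0 k hk (by omega)
    have h2 := h0 (m + 1) (by omega) le_rfl
    have h3 := hf m
    omega

lemma height_take_succ {w : List (Bool × Bool)} {k : ℕ} (hk : k < w.length) :
    height (w.take (k + 1)) = height (w.take k) + step w[k] := by
  rw [← List.take_concat_get' w k hk, height_append, height_cons, height_nil, add_zero]

lemma height_take_succ_le (w : List (Bool × Bool)) (k : ℕ) :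
    height (w.take (k + 1)) ≤ height (w.take k) + 1 ∧
      height (w.take k) - 1 ≤ height (w.take (k + 1)) := by
  rcases lt_or_ge k w.length with hk | hk
  · rw [height_take_succ hk]
    have h1 := step_le w[k]
    have h2 := le_step w[k]
    omega
  · rw [List.take_of_length_le hk, List.take_of_length_le (by omega)]
    omega

/-- The first `k` pairs of the dual are the last `k` of `w`, reversed and swapped; their height
vanishes exactly when the rest of `w` already has the full height. -/
lemma zeroAt_dual_iff {w : List (Bool × Bool)} {k : ℕ} :
    ZeroAt (dual w) k ↔ 0 < k ∧ k < w.length ∧ height (w.take (w.length - k)) = height w := by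
  have h := height_take_add_drop w (w.length - k)
  rw [ZeroAt, length_dual, dual, List.take_reverse, height_reverse, ← List.map_drop,
    height_map_swap, List.length_map]
  refine and_congr_right fun _ => and_congr_right fun _ => ?_
  omega

/-- The conditions of an overlap in terms of the height function. -/
lemma overlap_iff {g p : ℕ} (w : List (Bool × Bool)) (hp : 0 < p) (hg : 0 < g) :
    Overlap g (p + g) w ↔ p + g < w.length ∧ height (w.take (p + g)) = 0 ∧
      (∀ m, 0 < m → m < p + g → height (w.take m) ≠ 0) ∧ height (w.take p) = height w ∧
      ∀ m, p < m → m < w.length → height (w.take m) ≠ height w := by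
  constructor
  · rintro ⟨j, ⟨⟨h1, h2, h3⟩, h4⟩, ⟨h5, h6⟩, hj⟩
    rw [zeroAt_dual_iff] at h5
    obtain rfl : p = w.length - j := by omega
    refine ⟨h2, h3, fun m hm hm' h => ?_, h5.2.2, fun m hm hm' h => ?_⟩
    · have := h4 m ⟨hm, by omega, h⟩
      omega
    · have := h6 (w.length - m) (zeroAt_dual_iff.2
        ⟨by omega, by omega, by rwa [Nat.sub_sub_self hm'.le]⟩)
      omega
  · rintro ⟨h1, h2, h3, h4, h5⟩
    refine ⟨w.length - p, ⟨⟨by omega, h1, h2⟩, fun m hm => ?_⟩, ⟨zeroAt_dual_iff.2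
      ⟨by omega, by omega, by rwa [Nat.sub_sub_self (by omega)]⟩, fun m hm => ?_⟩, by omega⟩
    · by_contra h
      exact h3 m hm.1 (by omega) hm.2.2
    · rw [zeroAt_dual_iff] at hm
      by_contra h
      exact h5 (w.length - m) (by omega) (by omega) hm.2.2

lemma Overlap.lt {g i : ℕ} {w : List (Bool × Bool)} (h : Overlap g i w) : g < i := by
  obtain ⟨j, -, ⟨⟨-, h, -⟩, -⟩, hj⟩ := h
  rw [length_dual] at h
  omega

lemma overlap_map_swap {g i : ℕ} (hg : 0 < g) {w : List (Bool × Bool)} :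
    Overlap g i (w.map Prod.swap) ↔ Overlap g i w := by
  by_cases hi : g < i
  · obtain ⟨p, rfl⟩ : ∃ p, i = p + g := ⟨i - g, by omega⟩
    rw [overlap_iff _ (by omega) hg, overlap_iff _ (by omega) hg]
    simp only [List.length_map, ← List.map_take, height_map_swap, neg_eq_zero, neg_inj, ne_eq]
  · exact ⟨fun h => absurd h.lt hi, fun h => absurd h.lt hi⟩

/-! ### Decomposition at the descent -/

/-- The list composed of two lists with positive suffixes and a descent by `g`. -/
def glue (g : ℕ) (w₁ w₂ : List (Bool × Bool)) : List (Bool × Bool) :=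
  w₁.reverse ++ (List.replicate g (false, true) ++ w₂)

@[simp] lemma length_glue (g : ℕ) (w₁ w₂) :
    (glue g w₁ w₂).length = w₁.length + (g + w₂.length) := by simp [glue]

lemma height_replicate (k : ℕ) : height (List.replicate k (false, true)) = -k := by
  simp [height, step]

lemma height_glue {g : ℕ} {w₁ w₂ : List (Bool × Bool)} (h₁ : height w₁ = g)
    (h₂ : height w₂ = g) : height (glue g w₁ w₂) = g := by
  simp [glue, height_replicate, h₁, h₂]

lemma SuffixPos.height_take_lt {w : List (Bool × Bool)} (h : SuffixPos w) {k : ℕ}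
    (hk : k < w.length) : height (w.take k) < height w := by
  have h1 := h k hk
  have h2 := height_take_add_drop w k
  omega

lemma SuffixPos.height_take_reverse_pos {w : List (Bool × Bool)} (h : SuffixPos w) {k : ℕ}
    (hk : 0 < k) (hk' : k ≤ w.length) : 0 < height (w.reverse.take k) := by
  rw [List.take_reverse, height_reverse]
  exact h _ (by omega)

/-- The heights stay positive up to the value `g` at `p`, fall straight to 0 at `p + g`, and then
stay below `g` until the end. -/
lemma overlap_glue {g p q : ℕ} (hg : 0 < g) (hp : 0 < p) (hq : 0 < q) {w₁ w₂ : List (Bool × Bool)}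
    (h₁ : w₁ ∈ posListsOfHeight p g) (h₂ : w₂ ∈ posListsOfHeight q g) :
    Overlap g (p + g) (glue g w₁ w₂) := by
  obtain ⟨rfl, hs₁, hh₁⟩ := mem_posListsOfHeight.1 h₁
  obtain ⟨rfl, hs₂, hh₂⟩ := mem_posListsOfHeight.1 h₂
  have low : ∀ m, m ≤ w₁.length → (glue g w₁ w₂).take m = w₁.reverse.take m := fun m hm => by
    rw [glue, List.take_append_of_le_length (by simpa using hm)]
  have mid : ∀ m ≤ g, height ((glue g w₁ w₂).take (w₁.length + m)) = g - m := fun m hm => by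
    have e : (w₁.reverse ++ (List.replicate g (false, true) ++ w₂)).take (w₁.length + m) =
        w₁.reverse ++ List.replicate m (false, true) := by
      rw [← List.length_reverse, List.take_length_add_append,
        List.take_append_of_le_length (by simpa using hm), List.take_replicate, min_eq_left hm]
    rw [glue, e, height_append, height_reverse, height_replicate, hh₁]
    ring
  have high : ∀ m, height ((glue g w₁ w₂).take (w₁.length + (g + m))) = height (w₂.take m) :=
    fun m => by
      have e : (w₁.reverse ++ (List.replicate g (false, true) ++ w₂)).take (w₁.length + (g + m)) =
          w₁.reverse ++ (List.replicate g (false, true) ++ w₂.take m) := by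
        have e' := List.take_length_add_append (l₁ := List.replicate g (false, true))
          (l₂ := w₂) m
        rw [List.length_replicate] at e'
        rw [← List.length_reverse, List.take_length_add_append, e']
      rw [glue, e, height_append, height_append, height_reverse, height_replicate, hh₁]
      ring
  rw [overlap_iff _ hp hg, height_glue hh₁ hh₂]
  refine ⟨by simp; omega, by simpa using mid g le_rfl, fun m hm hm' => ?_,
    by simpa using mid 0 (Nat.zero_le _), fun m hm hm' => ?_⟩
  · rcases le_or_gt m w₁.length with h | h
    · rw [low m h]
      exact (hs₁.height_take_reverse_pos hm h).ne'
    · obtain ⟨k, rfl⟩ := Nat.exists_eq_add_of_lt h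
      rw [add_assoc, mid _ (by omega)]
      push_cast
      omega
  · rcases le_or_gt m (w₁.length + g) with h | h
    · obtain ⟨k, rfl⟩ := Nat.exists_eq_add_of_lt hm
      rw [add_assoc, mid _ (by omega)]
      push_cast
      omega
    · obtain ⟨k, rfl⟩ := Nat.exists_eq_add_of_lt h
      rw [length_glue] at hm'
      rw [add_assoc, add_assoc, high, ← hh₂]
      exact (hs₂.height_take_lt (by omega)).ne

/-- Here `g ≤ 2` is essential: for larger `g` the stretch from `p` to `p + g` could contain level or
rising steps. -/
lemma exists_glue_of_overlap {g p : ℕ} (hg : g = 1 ∨ g = 2) (hp : 0 < p)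
    {w : List (Bool × Bool)} (h : Overlap g (p + g) w) (hpos : 0 < height w) :
    ∃ w₁ ∈ posListsOfHeight p g, ∃ w₂ ∈ posListsOfHeight (w.length - (p + g)) g,
      w = glue g w₁ w₂ := by
  obtain ⟨hl, hz, h0, hd, h1⟩ := (overlap_iff w hp (by omega)).1 h
  have hstep := height_take_succ_le w
  have pre : ∀ m, 0 < m → m < p + g → 0 < height (w.take m) := by
    intro m hm hm'
    rcases le_total p m with hpm | hpm
    · exact pos_of_ne_zero_of_step (fun k => (hstep k).2) hpm
        (fun k hk hk' => h0 k (by omega) (by omega)) (by rwa [hd])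
    -- A negative height at `m ≤ p` would stay negative up to `p`, where the height is `height w >
    -- 0`.
    · by_contra hneg
      have := pos_of_ne_zero_of_step (f := fun k => -height (w.take k))
        (fun k => by have := (hstep k).1; omega) hpm
        (fun k hk hk' => neg_ne_zero.2 (h0 k (by omega) (by omega)))
        (by have := h0 m hm hm'; omega)
      omega
  have post : ∀ m, p + g ≤ m → m < w.length → height (w.take m) < height w := by
    intro m hm hm'
    have := pos_of_ne_zero_of_step (f := fun k => height w - height (w.take k))
      (fun k => by have := (hstep k).1; omega) hm
      (fun k hk hk' => sub_ne_zero.2 (h1 k (by omega) (by omega)).symm) (by omega)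
    omega
  have split : height w = g ∧ w.drop p = List.replicate g (false, true) ++ w.drop (p + g) := by
    have e0 := height_take_succ (w := w) (k := p) (by omega)
    have l0 := le_step w[p]
    rcases hg with rfl | rfl
    · have hs : step w[p] = -1 := by omega
      refine ⟨by push_cast; omega, ?_⟩
      rw [List.drop_eq_getElem_cons (by omega), eq_of_step_eq_neg_one hs]
      rfl
    -- The height at `p + 1` is positive and one step from 0, so it is 1. As `height w` differs from
    -- it and is at most 2, it is 2.
    · have e1 := height_take_succ (w := w) (k := p + 1) (by omega)
      have l1 := le_step w[p + 1]
      have n0 := pre (p + 1) (by omega) (by omega)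
      have n1 := h1 (p + 1) (by omega) (by omega)
      rw [add_assoc] at e1
      norm_num at e1
      have hs : step w[p] = -1 := by omega
      have hs' : step w[p + 1] = -1 := by omega
      refine ⟨by push_cast; omega, ?_⟩
      rw [List.drop_eq_getElem_cons (by omega), eq_of_step_eq_neg_one hs,
        List.drop_eq_getElem_cons (by omega), eq_of_step_eq_neg_one hs']
      rfl
  have hlp : (w.take p).length = p := by simp; omega
  refine ⟨(w.take p).reverse, mem_posListsOfHeight.2 ⟨by simpa using by omega, fun k hk => ?_, ?_⟩,
    w.drop (p + g), mem_posListsOfHeight.2 ⟨by simp, fun k hk => ?_, ?_⟩, ?_⟩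
  · rw [List.length_reverse, hlp] at hk
    rw [List.drop_reverse, height_reverse, hlp, List.take_take, min_eq_left (by omega)]
    exact pre _ (by omega) (by omega)
  · rw [height_reverse, hd, split.1]
  · rw [List.length_drop] at hk
    rw [List.drop_drop]
    have e := height_take_add_drop w (p + g + k)
    have := post (p + g + k) (by omega) (by omega)
    omega
  · have e := height_take_add_drop w (p + g)
    omega
  · rw [glue, List.reverse_reverse, ← split.2, List.take_append_drop]

/-! ### Parametrization of overlap pairs and the formulas -/

/-- Exchange the components of all letters, or not. -/
def swapIf (s : Bool) (w : List (Bool × Bool)) : List (Bool × Bool) :=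
  if s then w.map Prod.swap else w

lemma swapIf_swapIf (s : Bool) (w) : swapIf s (swapIf s w) = w := by
  cases s <;> simp [swapIf]

lemma overlap_swapIf {g i : ℕ} (hg : 0 < g) (s : Bool) {w : List (Bool × Bool)} :
    Overlap g i (swapIf s w) ↔ Overlap g i w := by
  cases s
  · rfl
  · exact overlap_map_swap hg

@[simp] lemma length_swapIf (s : Bool) (w) : (swapIf s w).length = w.length := by
  cases s <;> simp [swapIf]

lemma height_swapIf (s : Bool) (w) :
    height (swapIf s w) = if s then -height w else height w := by
  cases s <;> simp [swapIf]

/-- The data from which the codes of the overlap pairs are composed. -/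
noncomputable def overlapData (n g : ℕ) :
    Finset (Σ _ : ℕ, Bool × List (Bool × Bool) × List (Bool × Bool)) :=
  (Finset.Icc (g + 1) (n - 1)).sigma fun i =>
    Finset.univ ×ˢ posListsOfHeight (i - g) g ×ˢ posListsOfHeight (n - i) g

/-- The code composed of given data. -/
def compose (g : ℕ) (t : Σ _ : ℕ, Bool × List (Bool × Bool) × List (Bool × Bool)) :
    List (Bool × Bool) :=
  swapIf t.2.1 (glue g t.2.2.1 t.2.2.2)

lemma mem_overlapData {n g i : ℕ} {s : Bool} {w₁ w₂ : List (Bool × Bool)} :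
    (⟨i, s, w₁, w₂⟩ : Σ _ : ℕ, Bool × List (Bool × Bool) × List (Bool × Bool)) ∈ overlapData n g ↔
      (g + 1 ≤ i ∧ i ≤ n - 1) ∧ w₁ ∈ posListsOfHeight (i - g) g ∧
        w₂ ∈ posListsOfHeight (n - i) g := by
  simp [overlapData]

lemma overlap_compose {n g i : ℕ} (hg : 0 < g) {s : Bool} {w₁ w₂ : List (Bool × Bool)}
    (h : ⟨i, s, w₁, w₂⟩ ∈ overlapData n g) : Overlap g i (compose g ⟨i, s, w₁, w₂⟩) := by
  obtain ⟨hi, h₁, h₂⟩ := mem_overlapData.1 h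
  have := overlap_glue hg (by omega) (by omega) h₁ h₂
  rw [Nat.sub_add_cancel (by omega)] at this
  exact (overlap_swapIf hg s).2 this

/-- The code determines `i` as its first interior zero, `s` by the sign of its height, and then the
two lists by their lengths. -/
lemma injOn_compose {n g : ℕ} (hg : 0 < g) : Set.InjOn (compose g) (overlapData n g) := by
  rintro ⟨i, s, w₁, w₂⟩ h ⟨i', s', w₁', w₂'⟩ h' e
  rw [Finset.mem_coe] at h h'
  have o := overlap_compose hg h
  have o' := overlap_compose hg h'
  rw [← e] at o'
  obtain ⟨_, f, -⟩ := o
  obtain ⟨_, f', -⟩ := o'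
  obtain rfl := f.unique f'
  obtain ⟨-, h₁, h₂⟩ := mem_overlapData.1 h
  obtain ⟨-, h₁', h₂'⟩ := mem_overlapData.1 h'
  obtain ⟨l₁, -, t₁⟩ := mem_posListsOfHeight.1 h₁
  obtain ⟨l₂, -, t₂⟩ := mem_posListsOfHeight.1 h₂
  obtain ⟨l₁', -, t₁'⟩ := mem_posListsOfHeight.1 h₁'
  obtain ⟨l₂', -, t₂'⟩ := mem_posListsOfHeight.1 h₂'
  simp only [compose] at e
  obtain rfl : s = s' := by
    have := congrArg height e
    rw [height_swapIf, height_swapIf, height_glue t₁ t₂, height_glue t₁' t₂'] at this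
    cases s <;> cases s' <;> simp at this ⊢ <;> omega
  have e' := congrArg (swapIf s) e
  rw [swapIf_swapIf, swapIf_swapIf, glue, glue] at e'
  obtain ⟨r₁, r₂⟩ := List.append_inj e' (by simp [l₁, l₁'])
  rw [List.reverse_inj] at r₁
  rw [r₁, List.append_cancel_left r₂]

lemma overlapPairs_eq_image {n g : ℕ} (hg : g = 1 ∨ g = 2) :
    overlapPairs n g = decode '' (compose g '' (overlapData n g)) := by
  have hg' : 0 < g := by omega
  ext ⟨u, v⟩
  constructor
  · intro h
    obtain ⟨w, hw⟩ := exists_decode (h.1.trans h.2.1.symm)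
    rw [← hw, decode_mem_overlapPairs_iff] at h
    obtain ⟨rfl, i, h⟩ := h
    refine ⟨w, ?_, hw⟩
    obtain ⟨p, rfl⟩ : ∃ p, i = p + g := ⟨i - g, by have := h.lt; omega⟩
    have hp : 0 < p := by have := h.lt; omega
    have ho := (overlap_iff w hp hg').1 h
    -- The final height is attained at `p`, before the first interior zero, so its sign can be
    -- normalized.
    have hne : height w ≠ 0 := by
      rw [← ho.2.2.2.1]
      exact ho.2.2.1 p hp (by omega)
    obtain ⟨s, hs⟩ : ∃ s, 0 < height (swapIf s w) := by
      rcases hne.lt_or_gt with h | h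
      · exact ⟨true, by rw [height_swapIf]; simpa using h⟩
      · exact ⟨false, by rw [height_swapIf]; simpa using h⟩
    obtain ⟨w₁, h₁, w₂, h₂, e⟩ := exists_glue_of_overlap hg hp ((overlap_swapIf hg' s).2 h) hs
    rw [length_swapIf] at h₂
    refine ⟨⟨p + g, s, w₁, w₂⟩, Finset.mem_coe.2 (mem_overlapData.2
      ⟨⟨by omega, by have := ho.1; omega⟩, by rwa [Nat.add_sub_cancel], h₂⟩), ?_⟩
    rw [compose, ← e, swapIf_swapIf]
  · rintro ⟨_, ⟨⟨i, s, w₁, w₂⟩, h, rfl⟩, hw⟩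
    rw [Finset.mem_coe] at h
    rw [← hw, decode_mem_overlapPairs_iff]
    refine ⟨?_, i, overlap_compose hg' h⟩
    obtain ⟨hi, h₁, h₂⟩ := mem_overlapData.1 h
    have l₁ := (mem_posListsOfHeight.1 h₁).1
    have l₂ := (mem_posListsOfHeight.1 h₂).1
    rw [compose, length_swapIf, length_glue]
    dsimp only
    omega

lemma numOverlapPairs_eq {n g : ℕ} (hg : g = 1 ∨ g = 2) :
    numOverlapPairs n g = ∑ i ∈ Finset.Icc (g + 1) (n - 1),
      2 * ((posListsOfHeight (i - g) g).card * (posListsOfHeight (n - i) g).card) := by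
  rw [numOverlapPairs, overlapPairs_eq_image hg, Set.ncard_image_of_injective _ decode_injective,
    (injOn_compose (by omega)).ncard_image, Set.ncard_coe_finset, overlapData,
    Finset.card_sigma]
  simp

/-- Here `l₁` counts the `a`s in the first components of the list after the descent, and `m - l₁`
those of the list before it. -/
lemma numOverlapPairs_eq_sum {n g : ℕ} (hg : g = 1 ∨ g = 2) :
    (numOverlapPairs n g : ℚ) = 2 * ∑ i ∈ Finset.Icc (g + 1) (n - g),
      ∑ l₁ ∈ Finset.Icc g (n - i), ∑ m ∈ Finset.Icc (l₁ + g) (i + l₁ - g),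
        (g : ℚ) ^ 2 / (((i : ℚ) - g) * ((n : ℚ) - (i : ℚ))) *
          ((n - i).choose l₁ : ℚ) * ((n - i).choose (l₁ - g) : ℚ) *
          ((i - g).choose (m - l₁) : ℚ) * ((i - g).choose (m - l₁ - g) : ℚ) := by
  -- The extra indices with `n - g < i` contribute nothing, since then `l₁` ranges over an empty
  -- interval.
  have hsub : Finset.Icc (g + 1) (n - g) ⊆ Finset.Icc (g + 1) (n - 1) :=
    Finset.Icc_subset_Icc le_rfl (by omega)
  rw [Finset.sum_subset hsub, numOverlapPairs_eq hg, Nat.cast_sum, Finset.mul_sum]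
  · refine Finset.sum_congr rfl fun i hi => ?_
    rw [Finset.mem_Icc] at hi
    push_cast
    rw [card_posListsOfHeight_rat (by omega), card_posListsOfHeight_rat (by omega),
      mul_comm (∑ l ∈ _, _), Finset.sum_mul_sum]
    congr 1
    refine Finset.sum_congr rfl fun l₁ _ => ?_
    have e : Finset.Icc (l₁ + g) (i + l₁ - g) =
        (Finset.Icc g (i - g)).map (addLeftEmbedding l₁) := by
      rw [Finset.map_add_left_Icc]
      congr 1
      omega
    rw [e, Finset.sum_map]
    refine Finset.sum_congr rfl fun l _ => ?_
    rw [addLeftEmbedding_apply, Nat.add_sub_cancel_left, Nat.cast_sub (by omega),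
      Nat.cast_sub (by omega)]
    simp only [div_eq_mul_inv, mul_inv]
    ring
  · intro i _ hi
    rw [Finset.mem_Icc] at hi
    rw [Finset.Icc_eq_empty (a := g), Finset.sum_empty]
    rename_i h
    rw [Finset.mem_Icc] at h
    omega

end MAB

theorem proposition2p12 (n : ℕ) :
    ((MAB.numOverlapPairs n 1 : ℚ) =
      2 * ∑ i ∈ Finset.Icc 2 (n - 1), ∑ l₁ ∈ Finset.Icc 1 (n - i),
        ∑ m ∈ Finset.Icc (l₁ + 1) (i + l₁ - 1),
          1 / (((i : ℚ) - 1) * ((n : ℚ) - (i : ℚ))) *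
            ((n - i).choose l₁ : ℚ) * ((n - i).choose (l₁ - 1) : ℚ) *
            ((i - 1).choose (m - l₁) : ℚ) * ((i - 1).choose (m - l₁ - 1) : ℚ)) ∧
    ((MAB.numOverlapPairs n 2 : ℚ) =
      2 * ∑ i ∈ Finset.Icc 3 (n - 2), ∑ l₁ ∈ Finset.Icc 2 (n - i),
        ∑ m ∈ Finset.Icc (l₁ + 2) (i + l₁ - 2),
          4 / (((i : ℚ) - 2) * ((n : ℚ) - (i : ℚ))) *
            ((n - i).choose l₁ : ℚ) * ((n - i).choose (l₁ - 2) : ℚ) *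
            ((i - 2).choose (m - l₁) : ℚ) * ((i - 2).choose (m - l₁ - 2) : ℚ)) ∧
    (∀ x y : ℤ, MAB.numMiddleTriples (x - 1, y + 1) (x, y) (x, y + 1) = 1) ∧
    (∀ x y : ℤ, MAB.numMiddleTriples (x - 2, y + 2) (x, y) (x, y + 2) = 1) := by
  refine ⟨?_, ?_, fun x y => ?_, fun x y => ?_⟩
  · rw [MAB.numOverlapPairs_eq_sum (Or.inl rfl)]
    norm_num
  · rw [MAB.numOverlapPairs_eq_sum (Or.inr rfl)]
    norm_num
  · exact_mod_cast MAB.numMiddleTriples_eq_one 1 x y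
  · exact_mod_cast MAB.numMiddleTriples_eq_one 2 x y
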